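/- Consider a discrete-time Markov decision process whose state space $\mathbb{X}$ and action space $\mathbb{A}$ are Borel subsets of Polish spaces, with a measurable one-step cost $c:\mathbb{X}\times\mathbb{A}\to\mathbb{R}\cup\{+\infty\}$ that is bounded below, and a transition kernel $q(dy\mid x,a)$ from $\mathbb{X}\times\mathbb{A}$ to $\mathbb{X}$. Let $\Pi$ be the set of all (randomized, history-dependent) policies. For $\pi\in\Pi$ and an initial state $x$, let $\mathbb{E}_x^\pi$ be the expectation with respect to the probability on trajectories $(x_0,a_0,x_1,a_1,\dots)$ defined by $x$, $\pi$ and $q$ through the Ionescu Tulcea theorem. A deterministic policy is identified with a measurable map $\phi:\mathbb{X}\to\mathbb{A}$: it chooses the action $\phi(x)$ whenever the current state is $x$. For $x\in\mathbb{X}$ and $\alpha\in[0,1)$ put $$v_{N,1}^\pi(x)=\mathbb{E}_x^\pi\sum_{t=0}^{N-1}c(x_t,a_t),\qquad v_\alpha^\pi(x)=\mathbb{E}_x^\pi\sum_{t=0}^{\infty}\alpha^t c(x_t,a_t),\qquad v_\alpha(x)=\inf_{\pi\in\Pi}v_\alpha^\pi(x),\qquad m_\alpha=\inf_{x\in\mathbb{X}}v_\alpha(x),$$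 $$w^\pi(x)=\limsup_{N\to\infty}\tfrac1N v_{N,1}^\pi(x),\qquad w(x)=\inf_{\pi\in\Pi}w^\pi(x),\qquad w^*=\inf_{x\in\mathbb{X}}w(x),\qquad \overline{w}=\limsup_{\alpha\uparrow1}(1-\alpha)m_\alpha .$$ A policy $\pi$ is average-cost optimal if $w^\pi(x)=w(x)$ for all $x\in\mathbb{X}$. **Theorem.** Assume that $w^*<+\infty$. Let $\{\alpha_n\}$ be any sequence in $[0,1)$ with $\alpha_n\to1$ (in particular, any sequence $\alpha_n\uparrow1$), and put $\overline{w}_{\{\alpha_n\}}=\limsup_{n\to\infty}(1-\alpha_n)m_{\alpha_n}$. Suppose that a measurable function $u:\mathbb{X}\to[0,+\infty)$ and a deterministic policy $\phi$ satisfy $$c(x,\phi(x))+\int_{\mathbb{X}}u(y)\,q(dy\mid x,\phi(x))\le\overline{w}_{\{\alpha_n\}}+u(x),\qquad x\in\mathbb{X}.$$ Then $\phi$ is average-cost optimal; for each $x\in\mathbb{X}$, $$w(x)=w^\phi(x)=\limsup_{n\to\infty}(1-\alpha_n)v_{\alpha_n}(x)=\limsup_{\alpha\uparrow1}(1-\alpha)v_\alpha(x)=\overline{w}=\overline{w}_{\{\alpha_n\}}=w^*;$$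 and the weakened average-cost optimality inequality $$c(x,\phi(x))+\int_{\mathbb{X}}u(y)\,q(dy\mid x,\phi(x))\le\overline{w}+u(x),\qquad x\in\mathbb{X},$$ holds for the same $\phi$ and $u$. -/

import Mathlib

open MeasureTheory ProbabilityTheory Filter Topology
open scoped ENNReal NNReal

/-- A Markov decision process with state space `X` and action space `A` (all actions are available
in every state): a one-step cost `cost : X × A → ℝ ∪ {+∞}` that is jointly measurable and bounded
below (which excludes the value `-∞` of `EReal`), and a transition probability `trans` from `X × A`
to `X`. -/
structure MDP (X A : Type*) [MeasurableSpace X] [MeasurableSpace A] where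
  cost : X → A → EReal
  measurable_cost : Measurable (fun p : X × A => cost p.1 p.2)
  bddBelow_cost : ∃ K : ℝ, ∀ x a, (K : EReal) ≤ cost x a
  trans : Kernel (X × A) X
  isMarkovKernel_trans : IsMarkovKernel trans

/-- Histories `h_t = (x_0, a_0, …, x_{t-1}, a_{t-1}, x_t)`, that is `(X × A)^t × X`. -/
abbrev History (X A : Type*) (t : ℕ) : Type _ := (Fin t → X × A) × X

/-- A (randomized, history-dependent) policy: a sequence of transition probabilities
`π_t` from the space of histories up to time `t` to the action space. -/
structure Policy (X A : Type*) [MeasurableSpace X] [MeasurableSpace A] where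
  rule : (t : ℕ) → Kernel (History X A t) A
  isMarkovKernel_rule : ∀ t, IsMarkovKernel (rule t)

/-- The deterministic policy that chooses the action `φ x` whenever the current state is `x`. -/
noncomputable def Policy.deterministic {X A : Type*} [MeasurableSpace X] [MeasurableSpace A]
    (φ : X → A) (hφ : Measurable φ) : Policy X A where
  rule t := Kernel.deterministic (fun h : History X A t => φ h.2) (hφ.comp measurable_snd)
  isMarkovKernel_rule _ := inferInstance

/-- The state-action pairs of the epochs `0, …, n`, re-indexed by `Fin (n + 1)`. -/
def pastPairs {Z : Type*} (n : ℕ) (h : Finset.Iic n → Z) : Fin (n + 1) → Z :=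
  fun i => h ⟨i, Finset.mem_Iic.2 (Nat.lt_succ_iff.1 i.2)⟩

theorem measurable_pastPairs {Z : Type*} [MeasurableSpace Z] (n : ℕ) :
    Measurable (pastPairs (Z := Z) n) :=
  measurable_pi_lambda _ fun _ => measurable_pi_apply _

/-- The expectation of an extended-real-valued function: integral of the positive part minus
integral of the negative part. It is used only for measurable functions that are bounded below
on a probability space, for which the second integral is finite. -/
noncomputable def extExpectation {Ω : Type*} [MeasurableSpace Ω] (μ : Measure Ω)
    (f : Ω → EReal) : EReal :=
  ((∫⁻ ω, (f ω).toENNReal ∂μ : ℝ≥0∞) : EReal) - ((∫⁻ ω, (-f ω).toENNReal ∂μ : ℝ≥0∞) : EReal)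

namespace MDP

variable {X A : Type*} [MeasurableSpace X] [MeasurableSpace A]

/-- The conditional law of `(x_{n+1}, a_{n+1})` given `(x_0, a_0, …, x_n, a_n)` under `π`:
`x_{n+1}` has law `q(· | x_n, a_n)`, and then `a_{n+1}` has law
`π_{n+1}(· | x_0, a_0, …, x_n, a_n, x_{n+1})`. -/
noncomputable def stepKernel (M : MDP X A) (π : Policy X A) (n : ℕ) :
    Kernel (Finset.Iic n → X × A) (X × A) :=
  (M.trans.comap (fun h : Finset.Iic n → X × A => h ⟨n, Finset.mem_Iic.2 le_rfl⟩)
      (measurable_pi_apply _)) ⊗ₖ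
    ((π.rule (n + 1)).comap
      (fun p : (Finset.Iic n → X × A) × X => ((pastPairs n p.1, p.2) : History X A (n + 1)))
      (((measurable_pastPairs n).comp measurable_fst).prodMk measurable_snd))

instance isMarkovKernel_stepKernel (M : MDP X A) (π : Policy X A) (n : ℕ) :
    IsMarkovKernel (M.stepKernel π n) := by
  have := M.isMarkovKernel_trans
  have := π.isMarkovKernel_rule (n + 1)
  unfold stepKernel
  infer_instance

/-- The law of `(x_0, a_0)`: `x_0 = x`, and `a_0` has law `π_0(· | x)`. -/
noncomputable def initialLaw (π : Policy X A) (x : X) : Measure (X × A) :=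
  (π.rule 0 ((Fin.elim0, x) : History X A 0)).map (fun a => (x, a))

/-- The probability `P_x^π` on the set of trajectories `(x_0, a_0, x_1, a_1, …)`, given by the
Ionescu-Tulcea theorem. -/
noncomputable def pathMeasure (M : MDP X A) (π : Policy X A) (x : X) : Measure (ℕ → X × A) :=
  Kernel.trajMeasure (X := fun _ => X × A) (initialLaw π x) (M.stepKernel π)

/-- The expected total discounted cost over `N` epochs, `v_{N,α}^π(x)`. -/
noncomputable def finiteCost (M : MDP X A) (N : ℕ) (α : ℝ) (π : Policy X A) (x : X) : EReal :=
  extExpectation (M.pathMeasure π x) fun ω =>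
    ∑ t ∈ Finset.range N, ((α ^ t : ℝ) : EReal) * M.cost (ω t).1 (ω t).2

/-- For `0 ≤ α < 1` the discounted cost of each trajectory is a convergent series
in `ℝ ∪ {+∞}`. -/
theorem summable_discounted_cost (M : MDP X A) {α : ℝ} (h0 : 0 ≤ α) (h1 : α < 1)
    (ω : ℕ → X × A) :
    Summable fun t : ℕ => ((α ^ t : ℝ) : EReal) * M.cost (ω t).1 (ω t).2 := by
  obtain ⟨K, hK⟩ := M.bddBelow_cost
  have hg : ∀ t, 0 ≤ M.cost (ω t).1 (ω t).2 - (K : EReal) := fun t =>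
    (EReal.sub_nonneg (.inr (EReal.coe_ne_top K)) (.inr (EReal.coe_ne_bot K))).2 (hK _ _)
  have hsplit : ∀ t : ℕ, ((α ^ t : ℝ) : EReal) * M.cost (ω t).1 (ω t).2 =
      ((α ^ t * K : ℝ) : EReal) +
        ((ENNReal.ofReal (α ^ t) * (M.cost (ω t).1 (ω t).2 - (K : EReal)).toENNReal : ℝ≥0∞) :
          EReal) := by
    intro t
    rw [EReal.coe_ennreal_mul, EReal.coe_toENNReal (hg t), EReal.coe_ennreal_ofReal,
      max_eq_left (pow_nonneg h0 t), EReal.coe_mul,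
      ← EReal.left_distrib_of_nonneg_of_ne_top (EReal.coe_nonneg.2 (pow_nonneg h0 t))
        (EReal.coe_ne_top _), add_comm (K : EReal), EReal.sub_add_cancel]
  have h1' : HasSum (fun t : ℕ => ((α ^ t * K : ℝ) : EReal))
      ((∑' t : ℕ, α ^ t * K : ℝ) : EReal) :=
    ((summable_geometric_of_lt_one h0 h1).mul_right K).hasSum.map
      (⟨⟨fun r : ℝ => (r : EReal), rfl⟩, EReal.coe_add⟩ : ℝ →+ EReal)
      continuous_coe_real_ereal
  have h2' := (ENNReal.summable (f := fun t : ℕ =>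
      ENNReal.ofReal (α ^ t) * (M.cost (ω t).1 (ω t).2 - (K : EReal)).toENNReal)).hasSum.map
      (⟨⟨fun r : ℝ≥0∞ => (r : EReal), rfl⟩, EReal.coe_ennreal_add⟩ : ℝ≥0∞ →+ EReal)
      continuous_coe_ennreal_ereal
  have hadd := (EReal.continuousAt_add (p := (((∑' t : ℕ, α ^ t * K : ℝ) : EReal),
      ((∑' t : ℕ, ENNReal.ofReal (α ^ t) *
        (M.cost (ω t).1 (ω t).2 - (K : EReal)).toENNReal : ℝ≥0∞) : EReal)))
      (.inl (EReal.coe_ne_top _)) (.inl (EReal.coe_ne_bot _))).tendsto.comp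
      (h1'.prodMk_nhds h2')
  refine ⟨_, hadd.congr fun s => ?_⟩
  simp only [Function.comp_apply, hsplit, Finset.sum_add_distrib]
  rfl

/-- The infinite-horizon expected total discounted cost `v_α^π(x)`, for `0 ≤ α < 1`. -/
noncomputable def discCost (M : MDP X A) (α : ℝ) (π : Policy X A) (x : X) : EReal :=
  extExpectation (M.pathMeasure π x) fun ω =>
    ∑' t : ℕ, ((α ^ t : ℝ) : EReal) * M.cost (ω t).1 (ω t).2

/-- The discounted value function `v_α(x) = inf_π v_α^π(x)`. -/
noncomputable def discValue (M : MDP X A) (α : ℝ) (x : X) : EReal :=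
  ⨅ π : Policy X A, M.discCost α π x

/-- The average cost per unit time `w^π(x) = limsup_{N → ∞} N⁻¹ v_{N,1}^π(x)`. -/
noncomputable def avgCost (M : MDP X A) (π : Policy X A) (x : X) : EReal :=
  limsup (fun N : ℕ => (((N : ℝ)⁻¹ : ℝ) : EReal) * M.finiteCost N 1 π x) atTop

/-- The optimal average cost `w(x) = inf_π w^π(x)`. -/
noncomputable def avgValue (M : MDP X A) (x : X) : EReal :=
  ⨅ π : Policy X A, M.avgCost π x

/-- A policy is average-cost optimal if `w^π(x) = w(x)` for all `x`. -/
def IsAvgOptimal (M : MDP X A) (π : Policy X A) : Prop :=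
  ∀ x, M.avgCost π x = M.avgValue x

/-- `w^* = inf_x w(x)`. -/
noncomputable def wStar (M : MDP X A) : EReal := ⨅ x, M.avgValue x

/-- `m_α = inf_x v_α(x)`. -/
noncomputable def mDisc (M : MDP X A) (α : ℝ) : EReal := ⨅ x, M.discValue α x

/-- The upper limit of `(1 - α) m_α` as `α ↑ 1`. -/
noncomputable def wUpper (M : MDP X A) : EReal :=
  limsup (fun α : ℝ => ((1 - α : ℝ) : EReal) * M.mDisc α) (𝓝[<] 1)

/-- The upper limit of `(1 - α_n) m_{α_n}` as `n → ∞`. -/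
noncomputable def wUpperSeq (M : MDP X A) (α : ℕ → ℝ) : EReal :=
  limsup (fun n : ℕ => ((1 - α n : ℝ) : EReal) * M.mDisc (α n)) atTop

/-- The optimality inequality
`c(x, φ(x)) + ∫ u(y) q(dy | x, φ(x)) ≤ r + u(x)` for all `x`, with constant `r`. -/
def OptimalityInequality (M : MDP X A) (r : EReal) (φ : X → A) (u : X → ℝ≥0) : Prop :=
  ∀ x, M.cost x (φ x) + ((∫⁻ y, (u y : ℝ≥0∞) ∂(M.trans (x, φ x)) : ℝ≥0∞) : EReal)
    ≤ r + (((u x : ℝ≥0) : ℝ) : EReal)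

end MDP

/-! All the quantities lie on a closed cycle of inequalities. Iterating the optimality inequality
along `φ` and dividing by `N` gives `w^φ(x) ≤ wUpperSeq α` (`avgCost_deterministic_le`): the
terminal term in `u` is nonnegative and can be dropped, and `u x / N` vanishes. By definition `m_α ≤
v_α(x)`, and an upper limit along `α n` is at most the one as `β ↑ 1`; so `wUpperSeq α` is at most
the upper limit of `(1 - β) v_β(x)`. An Abelian inequality bounds the latter by `w^π(x)` for every
`π` (`limsup_discValue_le_avgCost`), hence by `w(x) ≤ w^φ(x)`. The cycle closes and all its terms
coincide; `wUpper` lies between two of them.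

To avoid extended-real arithmetic, the cost is written as a real lower bound `K` plus a `[0,
∞]`-valued excess, and the estimates are made for integrals of the excess against the laws of `(x_t,
a_t)`. -/

/-- If `f` is the sum of a real constant and a nonnegative measurable function, its extended
expectation on a probability space splits accordingly. -/
theorem extExpectation_eq_const_add_lintegral {Ω : Type*} [MeasurableSpace Ω] (μ : Measure Ω)
    [IsProbabilityMeasure μ] {f : Ω → EReal} {k : ℝ} {h : Ω → ℝ≥0∞} (hh : Measurable h)
    (hf : ∀ ω, f ω = (k : EReal) + (h ω : EReal)) :
    extExpectation μ f = (k : EReal) + ((∫⁻ ω, h ω ∂μ : ℝ≥0∞) : EReal) := by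
  have hfm : Measurable f := by
    rw [show f = fun ω => (k : EReal) + (h ω : EReal) from funext hf]
    exact measurable_const.add hh.coe_ereal_ennreal
  have hle : ∀ ω, (k : EReal) ≤ f ω := fun ω => by
    rw [hf]
    exact le_add_of_nonneg_right (EReal.coe_ennreal_nonneg _)
  -- This is `f⁺ - f⁻ = k⁺ - k⁻ + h` rearranged without subtraction, so it can be integrated in `[0,
  -- ∞]` even where `h` is infinite.
  have hpt : ∀ ω, (f ω).toENNReal + ENNReal.ofReal (-k) =
      (-f ω).toENNReal + (ENNReal.ofReal k + h ω) := by
    intro ω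
    rw [hf ω]
    rcases eq_or_ne (h ω) ⊤ with ht | ht
    · simp [ht]
    · lift h ω to ℝ≥0 using ht with r
      rw [show ((k : EReal) + ((r : ℝ≥0∞) : EReal)) = ((k + r : ℝ) : EReal) from rfl,
        ← EReal.coe_neg, EReal.real_coe_toENNReal, EReal.real_coe_toENNReal,
        ENNReal.ofReal, ENNReal.ofReal, ENNReal.ofReal, ENNReal.ofReal]
      norm_cast
      refine NNReal.coe_injective ?_
      simp only [NNReal.coe_add, Real.coe_toNNReal']
      have := r.coe_nonneg
      grind
  -- Finiteness of the negative part rules out `⊤ - ⊤` in the expectation.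
  have hneg : ∫⁻ ω, (-f ω).toENNReal ∂μ ≤ ENNReal.ofReal (-k) := by
    refine (lintegral_mono fun ω => ?_).trans_eq (by rw [lintegral_const, measure_univ, mul_one])
    rw [← EReal.real_coe_toENNReal, EReal.coe_neg]
    exact EReal.toENNReal_le_toENNReal (EReal.neg_le_neg_iff.2 (hle ω))
  have hint : ∫⁻ ω, (f ω).toENNReal ∂μ + ENNReal.ofReal (-k) =
      ∫⁻ ω, (-f ω).toENNReal ∂μ + (ENNReal.ofReal k + ∫⁻ ω, h ω ∂μ) := by
    have := lintegral_congr (μ := μ) hpt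
    rwa [lintegral_add_right _ measurable_const, lintegral_const, measure_univ, mul_one,
      lintegral_add_left (f := fun ω => (-f ω).toENNReal) hfm.neg.ereal_toENNReal,
      lintegral_add_left measurable_const,
      lintegral_const, measure_univ, mul_one] at this
  unfold extExpectation
  generalize ∫⁻ ω, (f ω).toENNReal ∂μ = P at *
  generalize ∫⁻ ω, (-f ω).toENNReal ∂μ = Q at *
  generalize ∫⁻ ω, h ω ∂μ = H at *
  lift Q to ℝ≥0 using (hneg.trans_lt ENNReal.ofReal_lt_top).ne
  rcases eq_or_ne H ⊤ with rfl | hH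
  · have hP : P = ⊤ := by simpa using hint
    simp [hP]
  · lift H to ℝ≥0 using hH
    have hP : P ≠ ⊤ := by
      rintro rfl
      rw [top_add, ENNReal.ofReal] at hint
      exact absurd hint.symm (by exact_mod_cast ENNReal.coe_ne_top)
    lift P to ℝ≥0 using hP
    simp only [ENNReal.ofReal] at hint
    norm_cast at hint
    replace hint := congrArg NNReal.toReal hint
    simp only [NNReal.coe_add, Real.coe_toNNReal'] at hint
    have : (P : ℝ) - Q = k + H := by grind
    exact congrArg Real.toEReal this

/-! ### Costs as a constant plus sums over the laws of state-action pairs -/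

namespace MDP

variable {X A : Type*} [MeasurableSpace X] [MeasurableSpace A]

instance isProbabilityMeasure_initialLaw (π : Policy X A) (x : X) :
    IsProbabilityMeasure (initialLaw π x) := by
  have := π.isMarkovKernel_rule 0
  exact Measure.isProbabilityMeasure_map measurable_prodMk_left.aemeasurable

instance isProbabilityMeasure_pathMeasure (M : MDP X A) (π : Policy X A) (x : X) :
    IsProbabilityMeasure (M.pathMeasure π x) := by
  unfold pathMeasure; infer_instance

/-- The excess of the one-step cost over a constant `K`. -/
noncomputable def excess (M : MDP X A) (K : ℝ) (z : X × A) : ℝ≥0∞ :=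
  (M.cost z.1 z.2 - (K : EReal)).toENNReal

theorem measurable_excess (M : MDP X A) (K : ℝ) : Measurable (M.excess K) :=
  (M.measurable_cost.sub measurable_const).ereal_toENNReal

theorem cost_eq_add_excess (M : MDP X A) {K : ℝ} (hK : ∀ x a, (K : EReal) ≤ M.cost x a)
    (z : X × A) : M.cost z.1 z.2 = (K : EReal) + (M.excess K z : EReal) := by
  rw [excess, EReal.coe_toENNReal ((EReal.sub_nonneg (.inr (EReal.coe_ne_top K))
    (.inr (EReal.coe_ne_bot K))).2 (hK _ _)), add_comm, EReal.sub_add_cancel]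

/-- The law of the state-action pair at epoch `t`. -/
noncomputable def pairLaw (M : MDP X A) (π : Policy X A) (x : X) (t : ℕ) : Measure (X × A) :=
  (M.pathMeasure π x).map fun ω => ω t

instance isProbabilityMeasure_pairLaw (M : MDP X A) (π : Policy X A) (x : X) (t : ℕ) :
    IsProbabilityMeasure (M.pairLaw π x t) :=
  Measure.isProbabilityMeasure_map (measurable_pi_apply t).aemeasurable

theorem lintegral_pairLaw (M : MDP X A) (π : Policy X A) (x : X) (t : ℕ) {F : X × A → ℝ≥0∞}
    (hF : Measurable F) :
    ∫⁻ z, F z ∂(M.pairLaw π x t) = ∫⁻ ω, F (ω t) ∂(M.pathMeasure π x) :=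
  lintegral_map hF (measurable_pi_apply t)

theorem discounted_cost_eq (M : MDP X A) {K : ℝ} (hK : ∀ x a, (K : EReal) ≤ M.cost x a)
    {r : ℝ} (hr : 0 ≤ r) (z : X × A) :
    (r : EReal) * M.cost z.1 z.2 =
      ((r * K : ℝ) : EReal) + ((ENNReal.ofReal r * M.excess K z : ℝ≥0∞) : EReal) := by
  rw [M.cost_eq_add_excess hK, EReal.coe_ennreal_mul, EReal.coe_ennreal_ofReal, max_eq_left hr,
    EReal.coe_mul, EReal.left_distrib_of_nonneg_of_ne_top (EReal.coe_nonneg.2 hr)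
      (EReal.coe_ne_top _)]

theorem finiteCost_one_eq (M : MDP X A) {K : ℝ} (hK : ∀ x a, (K : EReal) ≤ M.cost x a)
    (π : Policy X A) (x : X) (N : ℕ) :
    M.finiteCost N 1 π x = ((N * K : ℝ) : EReal) +
      ((∑ t ∈ Finset.range N, ∫⁻ z, M.excess K z ∂(M.pairLaw π x t) : ℝ≥0∞) : EReal) := by
  have hm := M.measurable_excess K
  have hterm : ∀ t, Measurable fun ω : ℕ → X × A => M.excess K (ω t) :=
    fun t => hm.comp (measurable_pi_apply t)
  simp only [M.lintegral_pairLaw π x _ hm]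
  rw [← lintegral_finsetSum _ fun t _ => hterm t]
  refine extExpectation_eq_const_add_lintegral _
    (Finset.measurable_sum _ fun t _ => hterm t) fun ω => ?_
  have h1 : ∀ t, ((1 ^ t : ℝ) : EReal) * M.cost (ω t).1 (ω t).2 =
      (K : EReal) + (M.excess K (ω t) : EReal) := fun t => by
    rw [one_pow, EReal.coe_one, one_mul, M.cost_eq_add_excess hK]
  simp only [h1]
  induction N with
  | zero => simp
  | succ n ih =>
    rw [Finset.sum_range_succ, ih, Finset.sum_range_succ, EReal.coe_ennreal_add, Nat.cast_succ,
      add_one_mul, EReal.coe_add]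
    exact add_add_add_comm _ _ _ _

/-- The constant part is a geometric series; Tonelli exchanges sum and expectation in the
nonnegative part, so only the one-epoch marginals matter. -/
theorem discCost_eq (M : MDP X A) {K : ℝ} (hK : ∀ x a, (K : EReal) ≤ M.cost x a)
    (π : Policy X A) (x : X) {β : ℝ} (h0 : 0 ≤ β) (h1 : β < 1) :
    M.discCost β π x = (((1 - β)⁻¹ * K : ℝ) : EReal) +
      ((∑' t, ENNReal.ofReal (β ^ t) * ∫⁻ z, M.excess K z ∂(M.pairLaw π x t) : ℝ≥0∞) :
        EReal) := by
  have hm := M.measurable_excess K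
  have hterm : ∀ t, Measurable fun ω : ℕ → X × A => ENNReal.ofReal (β ^ t) * M.excess K (ω t) :=
    fun t => (hm.comp (measurable_pi_apply t)).const_mul _
  simp only [M.lintegral_pairLaw π x _ hm]
  have hmul : ∀ t, ENNReal.ofReal (β ^ t) * ∫⁻ ω, M.excess K (ω t) ∂(M.pathMeasure π x) =
      ∫⁻ ω, ENNReal.ofReal (β ^ t) * M.excess K (ω t) ∂(M.pathMeasure π x) := fun t =>
    (lintegral_const_mul _ (hm.comp (measurable_pi_apply t))).symm
  simp only [hmul]
  rw [← lintegral_tsum fun t => (hterm t).aemeasurable]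
  refine extExpectation_eq_const_add_lintegral _ (Measurable.tsum hterm) fun ω => ?_
  simp only [M.discounted_cost_eq hK (pow_nonneg h0 _) (ω _)]
  have h1' : HasSum (fun t : ℕ => ((β ^ t * K : ℝ) : EReal)) (((1 - β)⁻¹ * K : ℝ) : EReal) :=
    ((hasSum_geometric_of_lt_one h0 h1).mul_right K).map
      (⟨⟨fun r : ℝ => (r : EReal), rfl⟩, EReal.coe_add⟩ : ℝ →+ EReal)
      continuous_coe_real_ereal
  have h2' := (ENNReal.summable (f := fun t : ℕ =>
      ENNReal.ofReal (β ^ t) * M.excess K (ω t))).hasSum.map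
      (⟨⟨fun r : ℝ≥0∞ => (r : EReal), rfl⟩, EReal.coe_ennreal_add⟩ : ℝ≥0∞ →+ EReal)
      continuous_coe_ennreal_ereal
  refine HasSum.tsum_eq ?_
  have hadd := (EReal.continuousAt_add (p := ((((1 - β)⁻¹ * K : ℝ) : EReal),
      ((∑' t : ℕ, ENNReal.ofReal (β ^ t) * M.excess K (ω t) : ℝ≥0∞) : EReal)))
      (.inl (EReal.coe_ne_top _)) (.inl (EReal.coe_ne_bot _))).tendsto.comp
      (h1'.prodMk_nhds h2')
  refine hadd.congr fun s => ?_
  simp only [Function.comp_apply, Finset.sum_add_distrib]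
  rfl

theorem one_sub_mul_discCost (M : MDP X A) {K : ℝ} (hK : ∀ x a, (K : EReal) ≤ M.cost x a)
    (π : Policy X A) (x : X) {β : ℝ} (h0 : 0 ≤ β) (h1 : β < 1) :
    ((1 - β : ℝ) : EReal) * M.discCost β π x = (K : EReal) +
      ((ENNReal.ofReal (1 - β) *
        ∑' t, ENNReal.ofReal (β ^ t) * ∫⁻ z, M.excess K z ∂(M.pairLaw π x t) : ℝ≥0∞) : EReal) := by
  have hβ : 0 < 1 - β := sub_pos.2 h1
  rw [M.discCost_eq hK π x h0 h1, EReal.left_distrib_of_nonneg_of_ne_top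
    (EReal.coe_nonneg.2 hβ.le) (EReal.coe_ne_top _), ← EReal.coe_mul,
    mul_inv_cancel_left₀ hβ.ne', EReal.coe_ennreal_mul, EReal.coe_ennreal_ofReal,
    max_eq_left hβ.le]

/-! ### One-step evolution of the state-action law -/

theorem pairLaw_zero (M : MDP X A) (π : Policy X A) (x : X) :
    M.pairLaw π x 0 = initialLaw π x := by
  have h : (M.pathMeasure π x).map (Preorder.frestrictLe 0) =
      (initialLaw π x).map (MeasurableEquiv.piUnique (fun _ : Finset.Iic 0 => X × A)).symm := by
    rw [pathMeasure, Kernel.trajMeasure, Measure.map_comp _ _ (by fun_prop),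
      Kernel.traj_map_frestrictLe, Kernel.partialTraj_self, Measure.id_comp]
  have hev : Measurable fun y : (Finset.Iic 0 → X × A) => y ⟨0, Finset.mem_Iic.2 le_rfl⟩ :=
    measurable_pi_apply _
  have h2 := congrArg (Measure.map fun y => y ⟨0, Finset.mem_Iic.2 le_rfl⟩) h
  rw [Measure.map_map hev (by fun_prop), Measure.map_map hev (by fun_prop)] at h2
  exact h2.trans Measure.map_id

/-- Under a deterministic policy the step kernel depends on the history only through its last pair,
so the one-epoch laws evolve by themselves. -/
theorem lintegral_pairLaw_succ (M : MDP X A) {φ : X → A} (hφ : Measurable φ) (x : X) (n : ℕ)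
    {F : X × A → ℝ≥0∞} (hF : Measurable F) :
    ∫⁻ z, F z ∂(M.pairLaw (Policy.deterministic φ hφ) x (n + 1)) =
      ∫⁻ z, ∫⁻ y, F (y, φ y) ∂(M.trans z) ∂(M.pairLaw (Policy.deterministic φ hφ) x n) := by
  set π := Policy.deterministic φ hφ
  have := M.isMarkovKernel_trans
  have := π.isMarkovKernel_rule (n + 1)
  have hG : Measurable fun z => ∫⁻ y, F (y, φ y) ∂(M.trans z) :=
    (hF.comp (measurable_id.prodMk hφ)).lintegral_kernel
  have hstep : ∀ h, ∫⁻ z, F z ∂(M.stepKernel π n h) =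
      ∫⁻ y, F (y, φ y) ∂(M.trans (h ⟨n, Finset.mem_Iic.2 le_rfl⟩)) := by
    intro h
    rw [stepKernel, Kernel.lintegral_compProd _ _ _ hF, Kernel.comap_apply]
    refine lintegral_congr fun y => ?_
    rw [Kernel.comap_apply]
    exact Kernel.lintegral_deterministic' (hφ.comp measurable_snd) (hF.comp measurable_prodMk_left)
  have key := Kernel.map_frestrictLe_trajMeasure_compProd_eq_map_trajMeasure
    (X := fun _ => X × A) (μ₀ := initialLaw π x) (κ := M.stepKernel π) (a := n)
  have key2 := congrArg (fun ν => ∫⁻ p, F p.2 ∂ν) key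
  have hF2 : Measurable fun p : (Finset.Iic n → X × A) × X × A => F p.2 :=
    hF.comp measurable_snd
  rw [Measure.lintegral_compProd hF2, lintegral_map hF2 (by fun_prop)] at key2
  rw [pairLaw, lintegral_map hF (measurable_pi_apply _), pairLaw,
    lintegral_map hG (measurable_pi_apply _)]
  refine key2.symm.trans ?_
  simp only [hstep]
  have hG2 : Measurable fun h : Finset.Iic n → X × A =>
      ∫⁻ y, F (y, φ y) ∂(M.trans (h ⟨n, Finset.mem_Iic.2 le_rfl⟩)) :=
    hG.comp (measurable_pi_apply _)
  rw [lintegral_map hG2 (by fun_prop)]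
  rfl

theorem lintegral_initialLaw_deterministic {φ : X → A} (hφ : Measurable φ) (x : X)
    {F : X × A → ℝ≥0∞} (hF : Measurable F) :
    ∫⁻ z, F z ∂(initialLaw (Policy.deterministic φ hφ) x) = F (x, φ x) := by
  rw [initialLaw, lintegral_map hF measurable_prodMk_left]
  exact Kernel.lintegral_deterministic' (hφ.comp measurable_snd) (hF.comp measurable_prodMk_left)

/-- The pair almost surely lies on the graph of `φ`, the only place where the optimality inequality
is available. -/
theorem lintegral_pairLaw_deterministic (M : MDP X A) {φ : X → A} (hφ : Measurable φ) (x : X)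
    (n : ℕ) {F : X × A → ℝ≥0∞} (hF : Measurable F) :
    ∫⁻ z, F z ∂(M.pairLaw (Policy.deterministic φ hφ) x n) =
      ∫⁻ z, F (z.1, φ z.1) ∂(M.pairLaw (Policy.deterministic φ hφ) x n) := by
  have hF' : Measurable fun z : X × A => F (z.1, φ z.1) :=
    hF.comp (measurable_fst.prodMk (hφ.comp measurable_fst))
  cases n with
  | zero =>
    rw [pairLaw_zero, lintegral_initialLaw_deterministic hφ x hF,
      lintegral_initialLaw_deterministic hφ x hF']
  | succ n => rw [lintegral_pairLaw_succ _ hφ x n hF, lintegral_pairLaw_succ _ hφ x n hF']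

/-- Iterating `g(x, φ x) + ∫ u dq ≤ r + u x` along the trajectories of `φ`. -/
theorem sum_lintegral_add_le (M : MDP X A) {φ : X → A} (hφ : Measurable φ) {g : X × A → ℝ≥0∞}
    (hg : Measurable g) {u : X → ℝ≥0∞} (hu : Measurable u) {r : ℝ≥0∞}
    (h : ∀ x, g (x, φ x) + ∫⁻ y, u y ∂(M.trans (x, φ x)) ≤ r + u x) (x : X) (N : ℕ) :
    (∑ t ∈ Finset.range N, ∫⁻ z, g z ∂(M.pairLaw (Policy.deterministic φ hφ) x t)) +
      ∫⁻ z, u z.1 ∂(M.pairLaw (Policy.deterministic φ hφ) x N) ≤ N * r + u x := by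
  have hu1 : Measurable fun z : X × A => u z.1 := hu.comp measurable_fst
  induction N with
  | zero =>
    rw [pairLaw_zero, lintegral_initialLaw_deterministic hφ x hu1]
    simp
  | succ n ih =>
    set μ := M.pairLaw (Policy.deterministic φ hφ) x n
    have : IsProbabilityMeasure μ := M.isProbabilityMeasure_pairLaw _ x n
    have hk : Measurable fun z : X × A => ∫⁻ y, u y ∂(M.trans z) := hu.lintegral_kernel
    have hone : ∫⁻ z, g z ∂μ + ∫⁻ z, ∫⁻ y, u y ∂(M.trans z) ∂μ ≤ r + ∫⁻ z, u z.1 ∂μ := by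
      rw [← lintegral_add_left hg]
      refine (lintegral_pairLaw_deterministic M hφ x n (hg.add hk)).trans_le ?_
      refine (lintegral_mono fun z : X × A => h z.1).trans_eq ?_
      rw [lintegral_add_left measurable_const, lintegral_const, measure_univ, mul_one]
    rw [Finset.sum_range_succ, lintegral_pairLaw_succ M hφ x n hu1, add_assoc]
    calc _ ≤ (∑ t ∈ Finset.range n, ∫⁻ z, g z ∂(M.pairLaw (Policy.deterministic φ hφ) x t)) +
          (r + ∫⁻ z, u z.1 ∂μ) := by gcongr
      _ = r + ((∑ t ∈ Finset.range n,
          ∫⁻ z, g z ∂(M.pairLaw (Policy.deterministic φ hφ) x t)) + ∫⁻ z, u z.1 ∂μ) := by ring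
      _ ≤ r + (n * r + u x) := by gcongr
      _ = _ := by push_cast; ring

end MDP

/-! ### An Abelian inequality in `[0, ∞]` -/

/-- If `∑_{t < n} a t ≤ C + n L` for all `n`, then the geometrically weighted sums satisfy
`∑_{t < n} b ^ t a t ≤ C + L ∑_{t < n} b ^ t`. -/
theorem ENNReal.sum_pow_mul_le_of_sum_le {b L : ℝ≥0∞} (hb : b ≤ 1) (hL : L ≠ ⊤) (n : ℕ)
    {a : ℕ → ℝ≥0∞} {C : ℝ≥0∞} (hC : C ≠ ⊤)
    (h : ∀ n : ℕ, ∑ t ∈ Finset.range n, a t ≤ C + n * L) :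
    ∑ t ∈ Finset.range n, b ^ t * a t ≤ C + L * ∑ t ∈ Finset.range n, b ^ t := by
  -- Peel off `a 0`: the shifted sequence satisfies the same hypothesis with `C' = C + L - a 0`,
  -- which is why `a` and `C` must vary. Then `b * C' ≤ C'` restores the bound.
  induction n generalizing a C with
  | zero => simp
  | succ n ih =>
    have h0 : a 0 ≤ C + L := by simpa using h 1
    have ha : a 0 ≠ ⊤ := ne_top_of_le_ne_top (ENNReal.add_ne_top.2 ⟨hC, hL⟩) h0
    obtain ⟨C', hC'⟩ := exists_add_of_le h0
    have hC'top : C' ≠ ⊤ := ne_top_of_le_ne_top (ENNReal.add_ne_top.2 ⟨hC, hL⟩)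
      (hC' ▸ le_add_self)
    have hshift := ih (a := fun t => a (t + 1)) hC'top fun m => by
      have hm := h (m + 1)
      rw [Finset.sum_range_succ', add_comm, Nat.cast_succ, add_one_mul, add_comm _ L, ← add_assoc,
        hC', add_assoc] at hm
      exact (ENNReal.add_le_add_iff_left ha).1 hm
    have hsucc : ∀ f : ℕ → ℝ≥0∞, ∑ t ∈ Finset.range n, b ^ (t + 1) * f t =
        b * ∑ t ∈ Finset.range n, b ^ t * f t := fun f => by
      rw [Finset.mul_sum]
      exact Finset.sum_congr rfl fun t _ => by ring
    have hone := hsucc 1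
    simp only [Pi.one_apply, mul_one] at hone
    rw [Finset.sum_range_succ', Finset.sum_range_succ', hsucc, hone, pow_zero, one_mul]
    calc b * ∑ t ∈ Finset.range n, b ^ t * a (t + 1) + a 0
        ≤ b * (C' + L * ∑ t ∈ Finset.range n, b ^ t) + a 0 := by gcongr
      _ ≤ (a 0 + C') + L * (b * ∑ t ∈ Finset.range n, b ^ t) := by
        rw [mul_add, mul_left_comm b L]
        calc b * C' + L * (b * ∑ t ∈ Finset.range n, b ^ t) + a 0
            ≤ 1 * C' + L * (b * ∑ t ∈ Finset.range n, b ^ t) + a 0 := by gcongr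
          _ = _ := by ring
      _ = _ := by rw [← hC']; ring

/-- The Abelian inequality: linear growth of the partial sums at rate `L` bounds the normalized
discounted sums by `L`, up to a vanishing term. -/
theorem ENNReal.one_sub_mul_tsum_le_of_sum_le {L C : ℝ≥0∞} (hL : L ≠ ⊤) (hC : C ≠ ⊤)
    {a : ℕ → ℝ≥0∞} (h : ∀ n : ℕ, ∑ t ∈ Finset.range n, a t ≤ C + n * L)
    {β : ℝ} (h0 : 0 ≤ β) (h1 : β < 1) :
    ENNReal.ofReal (1 - β) * ∑' t, ENNReal.ofReal (β ^ t) * a t ≤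
      ENNReal.ofReal (1 - β) * C + L := by
  have hb : ENNReal.ofReal β < 1 := ENNReal.ofReal_lt_one.2 h1
  have hsum : ∑' t, ENNReal.ofReal (β ^ t) * a t ≤ C + L * (1 - ENNReal.ofReal β)⁻¹ := by
    simp only [ENNReal.ofReal_pow h0]
    refine ENNReal.tsum_le_of_sum_range_le fun n => ?_
    refine (ENNReal.sum_pow_mul_le_of_sum_le hb.le hL n hC h).trans ?_
    rw [← ENNReal.tsum_geometric]
    gcongr
    exact ENNReal.sum_le_tsum _
  have hsub : ENNReal.ofReal (1 - β) = 1 - ENNReal.ofReal β := by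
    rw [ENNReal.ofReal_sub _ h0, ENNReal.ofReal_one]
  rw [hsub]
  calc _ ≤ (1 - ENNReal.ofReal β) * (C + L * (1 - ENNReal.ofReal β)⁻¹) := by gcongr
    _ = (1 - ENNReal.ofReal β) * C +
        L * ((1 - ENNReal.ofReal β) * (1 - ENNReal.ofReal β)⁻¹) := by ring
    _ = _ := by
      rw [ENNReal.mul_inv_cancel (tsub_pos_of_lt hb).ne' (by finiteness), mul_one]

/-! ### Passing between `EReal` and `ℝ≥0∞` by a real shift -/

theorem EReal.le_toENNReal_sub_of_add_le {k : ℝ} {y : ℝ≥0∞} {L : EReal}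
    (h : (k : EReal) + (y : EReal) ≤ L) : y ≤ (L - (k : EReal)).toENNReal := by
  rw [← EReal.toENNReal_coe (x := y)]
  refine EReal.toENNReal_le_toENNReal ?_
  rwa [EReal.le_sub_iff_add_le (.inl (EReal.coe_ne_bot _)) (.inl (EReal.coe_ne_top _)), add_comm]

theorem EReal.coe_add_toENNReal_sub {k : ℝ} {L : EReal} (h : (k : EReal) ≤ L) :
    (k : EReal) + ((L - (k : EReal)).toENNReal : EReal) = L := by
  rw [EReal.coe_toENNReal ((EReal.sub_nonneg (.inr (EReal.coe_ne_top _))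
    (.inr (EReal.coe_ne_bot _))).2 h), add_comm, EReal.sub_add_cancel]

theorem EReal.tendsto_const_add_coe_ennreal {ι : Type*} {l : Filter ι} (k : ℝ) {f : ι → ℝ≥0∞}
    {y : ℝ≥0∞} (h : Tendsto f l (𝓝 y)) :
    Tendsto (fun i => (k : EReal) + (f i : EReal)) l (𝓝 ((k : EReal) + (y : EReal))) :=
  (EReal.continuousAt_add (p := ((k : EReal), (y : EReal))) (.inl (EReal.coe_ne_top _))
    (.inl (EReal.coe_ne_bot _))).tendsto.comp
      (tendsto_const_nhds.prodMk_nhds (continuous_coe_ennreal_ereal.tendsto y |>.comp h))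

/-! ### Comparison of average and discounted costs -/

namespace MDP

variable {X A : Type*} [MeasurableSpace X] [MeasurableSpace A]

theorem inv_mul_finiteCost_one (M : MDP X A) {K : ℝ} (hK : ∀ x a, (K : EReal) ≤ M.cost x a)
    (π : Policy X A) (x : X) {N : ℕ} (hN : N ≠ 0) :
    (((N : ℝ)⁻¹ : ℝ) : EReal) * M.finiteCost N 1 π x = (K : EReal) +
      (((N : ℝ≥0∞)⁻¹ * ∑ t ∈ Finset.range N, ∫⁻ z, M.excess K z ∂(M.pairLaw π x t) : ℝ≥0∞) :
        EReal) := by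
  have hN0 : (0 : ℝ) < N := by exact_mod_cast Nat.pos_of_ne_zero hN
  have hinv : ((N : ℝ≥0∞)⁻¹) = ENNReal.ofReal (N : ℝ)⁻¹ := by
    rw [ENNReal.ofReal_inv_of_pos hN0, ENNReal.ofReal_natCast]
  rw [M.finiteCost_one_eq hK, EReal.left_distrib_of_nonneg_of_ne_top
    (EReal.coe_nonneg.2 (inv_nonneg.2 hN0.le)) (EReal.coe_ne_top _), ← EReal.coe_mul,
    inv_mul_cancel_left₀ hN0.ne', hinv, EReal.coe_ennreal_mul, EReal.coe_ennreal_ofReal,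
    max_eq_left (inv_nonneg.2 hN0.le)]

/-- The upper limit of the normalized discounted values is at most the average cost of any
policy. -/
theorem limsup_discValue_le_avgCost (M : MDP X A) (π : Policy X A) (x : X) :
    limsup (fun β : ℝ => ((1 - β : ℝ) : EReal) * M.discValue β x) (𝓝[<] 1) ≤ M.avgCost π x := by
  obtain ⟨K, hK⟩ := M.bddBelow_cost
  -- It suffices to treat real `L` strictly above the average cost; this keeps `L'` finite.
  refine EReal.le_of_forall_lt_iff_le.1 fun L hL => ?_
  set a : ℕ → ℝ≥0∞ := fun t => ∫⁻ z, M.excess K z ∂(M.pairLaw π x t)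
  set L' : ℝ≥0∞ := ((L : EReal) - (K : EReal)).toENNReal with hL'
  have hL'top : L' ≠ ⊤ := by
    rw [hL', ← EReal.coe_sub, EReal.real_coe_toENNReal]
    exact ENNReal.ofReal_ne_top
  obtain ⟨N₀, hN₀⟩ := eventually_atTop.1
    ((eventually_lt_of_limsup_lt hL).and (eventually_ne_atTop 0))
  have hbound : ∀ N ≥ N₀, ((N : ℝ≥0∞)⁻¹ * ∑ t ∈ Finset.range N, a t) ≤ L' ∧
      (K : EReal) ≤ L := by
    intro N hN
    obtain ⟨h1, h2⟩ := hN₀ N hN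
    rw [M.inv_mul_finiteCost_one hK π x h2] at h1
    exact ⟨EReal.le_toENNReal_sub_of_add_le h1.le,
      (le_add_of_nonneg_right (EReal.coe_ennreal_nonneg _)).trans h1.le⟩
  have hKL : (K : EReal) ≤ L := (hbound N₀ le_rfl).2
  have hlin : ∀ N ≥ N₀, ∑ t ∈ Finset.range N, a t ≤ N * L' := fun N hN =>
    (ENNReal.inv_mul_le_iff (by exact_mod_cast (hN₀ N hN).2) (ENNReal.natCast_ne_top N)).1
      (hbound N hN).1
  -- The bound `N * L'` holds only for `N ≥ N₀`; earlier partial sums are at most the one at `N₀`,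
  -- which `C` absorbs.
  set C : ℝ≥0∞ := N₀ * L'
  have hCtop : C ≠ ⊤ := ENNReal.mul_ne_top (ENNReal.natCast_ne_top _) hL'top
  have hsum : ∀ N : ℕ, ∑ t ∈ Finset.range N, a t ≤ C + N * L' := fun N => by
    rcases le_total N₀ N with h | h
    · exact (hlin N h).trans le_add_self
    · exact ((Finset.sum_le_sum_of_subset (Finset.range_mono h)).trans
        (hlin N₀ le_rfl)).trans le_self_add
  have hev : ∀ᶠ β : ℝ in 𝓝[<] 1, ((1 - β : ℝ) : EReal) * M.discValue β x ≤
      (K : EReal) + ((ENNReal.ofReal (1 - β) * C + L' : ℝ≥0∞) : EReal) := by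
    filter_upwards [Ioo_mem_nhdsLT (zero_lt_one' ℝ)] with β hβ
    have h1 : ((1 - β : ℝ) : EReal) * M.discValue β x ≤
        ((1 - β : ℝ) : EReal) * M.discCost β π x :=
      mul_le_mul_of_nonneg_left (iInf_le _ π) (EReal.coe_nonneg.2 (sub_nonneg.2 hβ.2.le))
    refine h1.trans ?_
    rw [M.one_sub_mul_discCost hK π x hβ.1.le hβ.2]
    gcongr
    exact EReal.coe_ennreal_le_coe_ennreal_iff.2
      (ENNReal.one_sub_mul_tsum_le_of_sum_le hL'top hCtop hsum hβ.1.le hβ.2)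
  have hlim : Tendsto (fun β : ℝ => ENNReal.ofReal (1 - β) * C + L') (𝓝[<] 1) (𝓝 L') := by
    have h1 : Tendsto (fun β : ℝ => ENNReal.ofReal (1 - β)) (𝓝[<] 1) (𝓝 0) := by
      have : Continuous fun β : ℝ => ENNReal.ofReal (1 - β) :=
        ENNReal.continuous_ofReal.comp (continuous_const.sub continuous_id)
      simpa using (this.tendsto 1).mono_left nhdsWithin_le_nhds
    simpa using (ENNReal.Tendsto.mul_const h1 (.inr hCtop)).add_const L'
  refine (limsup_le_limsup hev).trans ?_
  rw [(EReal.tendsto_const_add_coe_ennreal K hlim).limsup_eq, EReal.coe_add_toENNReal_sub hKL]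

theorem le_one_sub_mul_mDisc (M : MDP X A) {K : ℝ} (hK : ∀ x a, (K : EReal) ≤ M.cost x a)
    {β : ℝ} (h0 : 0 ≤ β) (h1 : β < 1) : (K : EReal) ≤ ((1 - β : ℝ) : EReal) * M.mDisc β := by
  have hβ : 0 < 1 - β := sub_pos.2 h1
  have hm : (((1 - β)⁻¹ * K : ℝ) : EReal) ≤ M.mDisc β := le_iInf fun x => le_iInf fun π => by
    rw [M.discCost_eq hK π x h0 h1]
    exact le_add_of_nonneg_right (EReal.coe_ennreal_nonneg _)
  calc (K : EReal) = ((1 - β : ℝ) : EReal) * (((1 - β)⁻¹ * K : ℝ) : EReal) := by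
        rw [← EReal.coe_mul, mul_inv_cancel_left₀ hβ.ne']
    _ ≤ _ := mul_le_mul_of_nonneg_left hm (EReal.coe_nonneg.2 hβ.le)

/-- A solution of the optimality inequality with constant `w` bounds the average cost by `w`. -/
theorem avgCost_deterministic_le (M : MDP X A) {K : ℝ} (hK : ∀ x a, (K : EReal) ≤ M.cost x a)
    {w : EReal} (hw : (K : EReal) ≤ w) {u : X → ℝ≥0} (hu : Measurable u) {φ : X → A}
    (hφ : Measurable φ) (h : M.OptimalityInequality w φ u) (x : X) :
    M.avgCost (Policy.deterministic φ hφ) x ≤ w := by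
  -- The value `r = ⊤` is allowed, so no finiteness of `w` is needed.
  set r : ℝ≥0∞ := (w - (K : EReal)).toENNReal
  have hwr : (K : EReal) + (r : EReal) = w := EReal.coe_add_toENNReal_sub hw
  have hstep : ∀ y, M.excess K (y, φ y) + ∫⁻ z, (u z : ℝ≥0∞) ∂(M.trans (y, φ y)) ≤
      r + (u y : ℝ≥0∞) := by
    intro y
    have hy := h y
    rw [M.cost_eq_add_excess hK (y, φ y), ← hwr, add_assoc, add_assoc,
      ← EReal.coe_ennreal_add] at hy
    have := EReal.le_toENNReal_sub_of_add_le hy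
    rwa [EReal.add_sub_cancel_left, show (((u y : ℝ≥0) : ℝ) : EReal) = ((u y : ℝ≥0∞) : EReal)
      from rfl, ← EReal.coe_ennreal_add, EReal.toENNReal_coe] at this
  have hN : ∀ᶠ N : ℕ in atTop, (((N : ℝ)⁻¹ : ℝ) : EReal) *
      M.finiteCost N 1 (Policy.deterministic φ hφ) x ≤
      (K : EReal) + ((r + (N : ℝ≥0∞)⁻¹ * (u x : ℝ≥0∞) : ℝ≥0∞) : EReal) := by
    filter_upwards [eventually_ne_atTop 0] with N hN
    rw [M.inv_mul_finiteCost_one hK _ x hN]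
    gcongr
    refine EReal.coe_ennreal_le_coe_ennreal_iff.2 ?_
    -- Here the nonnegative terminal integral of `u` is discarded.
    have hs := le_self_add.trans
      (M.sum_lintegral_add_le hφ (M.measurable_excess K) hu.coe_nnreal_ennreal hstep x N)
    refine (mul_le_mul_right hs _).trans_eq ?_
    rw [mul_add, ← mul_assoc, ENNReal.inv_mul_cancel (by simpa using hN) (by simp), one_mul]
  refine (limsup_le_limsup hN).trans ?_
  have hlim : Tendsto (fun N : ℕ => r + (N : ℝ≥0∞)⁻¹ * (u x : ℝ≥0∞)) atTop (𝓝 r) := by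
    simpa using (ENNReal.Tendsto.mul_const ENNReal.tendsto_inv_nat_nhds_zero
      (.inr ENNReal.coe_ne_top)).const_add r
  rw [(EReal.tendsto_const_add_coe_ennreal K hlim).limsup_eq, hwr]

end MDP

/-! ### Closing the cycle of inequalities -/

theorem mainTheorem1 {X A : Type*} [MeasurableSpace X] [StandardBorelSpace X]
    [MeasurableSpace A] [StandardBorelSpace A] (M : MDP X A)
    (hB : M.wStar < ⊤)
    (α : ℕ → ℝ) (hα : ∀ n, α n ∈ Set.Ico (0 : ℝ) 1) (hα_lim : Tendsto α atTop (𝓝 1))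
    (u : X → ℝ≥0) (hu : Measurable u) (φ : X → A) (hφ : Measurable φ)
    (hineq : M.OptimalityInequality (M.wUpperSeq α) φ u) :
    M.IsAvgOptimal (Policy.deterministic φ hφ) ∧
    (∀ x : X,
      M.avgValue x = M.avgCost (Policy.deterministic φ hφ) x ∧
      M.avgCost (Policy.deterministic φ hφ) x =
        limsup (fun n : ℕ => ((1 - α n : ℝ) : EReal) * M.discValue (α n) x) atTop ∧
      limsup (fun n : ℕ => ((1 - α n : ℝ) : EReal) * M.discValue (α n) x) atTop =
        limsup (fun β : ℝ => ((1 - β : ℝ) : EReal) * M.discValue β x) (𝓝[<] 1) ∧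
      limsup (fun β : ℝ => ((1 - β : ℝ) : EReal) * M.discValue β x) (𝓝[<] 1) = M.wUpper ∧
      M.wUpper = M.wUpperSeq α ∧
      M.wUpperSeq α = M.wStar) ∧
    M.OptimalityInequality M.wUpper φ u := by
  obtain ⟨K, hK⟩ := M.bddBelow_cost
  have hα' : Tendsto α atTop (𝓝[<] 1) :=
    tendsto_nhdsWithin_iff.2 ⟨hα_lim, Eventually.of_forall fun n => (hα n).2⟩
  have hKw : (K : EReal) ≤ M.wUpperSeq α := by
    refine le_trans ?_ (limsup_le_limsup (Eventually.of_forall fun n =>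
      M.le_one_sub_mul_mDisc hK (hα n).1 (hα n).2))
    rw [limsup_const]
  have hmul : ∀ (x : X) {β : ℝ}, β < 1 →
      ((1 - β : ℝ) : EReal) * M.mDisc β ≤ ((1 - β : ℝ) : EReal) * M.discValue β x :=
    fun x β hβ => mul_le_mul_of_nonneg_left (iInf_le _ x)
      (EReal.coe_nonneg.2 (sub_nonneg.2 hβ.le))
  have hcomp : ∀ f : ℝ → EReal, limsup (fun n => f (α n)) atTop ≤ limsup f (𝓝[<] 1) := fun f =>
    limsup_le_limsup_of_le (u := f) hα'
  have hseq : M.wUpperSeq α ≤ M.wUpper :=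
    hcomp fun β => ((1 - β : ℝ) : EReal) * M.mDisc β
  have h1 : ∀ x, M.avgCost (Policy.deterministic φ hφ) x ≤ M.wUpperSeq α :=
    M.avgCost_deterministic_le hK hKw hu hφ hineq
  have h2 : ∀ x, M.wUpperSeq α ≤
      limsup (fun n : ℕ => ((1 - α n : ℝ) : EReal) * M.discValue (α n) x) atTop := fun x =>
    limsup_le_limsup (Eventually.of_forall fun n => hmul x (hα n).2)
  have h3 : ∀ x, limsup (fun n : ℕ => ((1 - α n : ℝ) : EReal) * M.discValue (α n) x) atTop ≤
      limsup (fun β : ℝ => ((1 - β : ℝ) : EReal) * M.discValue β x) (𝓝[<] 1) := fun x =>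
    hcomp fun β => ((1 - β : ℝ) : EReal) * M.discValue β x
  have h4 : ∀ x, M.wUpper ≤
      limsup (fun β : ℝ => ((1 - β : ℝ) : EReal) * M.discValue β x) (𝓝[<] 1) := fun x =>
    limsup_le_limsup (eventually_mem_nhdsWithin.mono fun β hβ => hmul x hβ)
  have h5 : ∀ x, limsup (fun β : ℝ => ((1 - β : ℝ) : EReal) * M.discValue β x) (𝓝[<] 1) ≤
      M.avgValue x := fun x => le_iInf fun π => M.limsup_discValue_le_avgCost π x
  have h6 : ∀ x, M.avgValue x ≤ M.avgCost (Policy.deterministic φ hφ) x := fun x =>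
    iInf_le _ _
  have hval : ∀ x, M.avgValue x = M.wUpperSeq α := fun x =>
    le_antisymm ((h6 x).trans (h1 x)) ((h2 x).trans ((h3 x).trans (h5 x)))
  -- The weakened inequality needs only `hseq`, since enlarging the constant preserves it.
  refine ⟨fun x => le_antisymm ((h1 x).trans (hval x).ge) (h6 x), fun x => ?_, fun x =>
    (hineq x).trans (by gcongr)⟩
  -- The infimum of a constant over an empty `X` would be `⊤`; the given point excludes this.
  have : Nonempty X := ⟨x⟩
  have hstar : M.wStar = M.wUpperSeq α := by
    unfold MDP.wStar
    simp only [hval, ciInf_const]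
  have hupper : M.wUpper = M.wUpperSeq α :=
    le_antisymm ((h4 x).trans ((h5 x).trans (hval x).le)) hseq
  refine ⟨le_antisymm (h6 x) ((h1 x).trans (hval x).ge),
    le_antisymm ((h1 x).trans (h2 x)) ((h3 x).trans ((h5 x).trans (h6 x))),
    le_antisymm (h3 x) ((h5 x).trans ((hval x).le.trans (h2 x))),
    le_antisymm ((h5 x).trans ((hval x).le.trans hseq)) (h4 x), hupper, hstar.symm⟩
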